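/- Let $\{\varepsilon_{k,\ell} : k,\ell\ge 1\}$ be independent real random variables on a probability space with $\mathsf E\,\varepsilon_{k,\ell}=0$ and $\mathrm{Var}\,\varepsilon_{k,\ell}=1$. For real $\alpha,\beta,\gamma$ define the spatial autoregressive process $\{X_{k,\ell}: k,\ell\ge 0\}$ by $$X_{k,\ell}=\alpha X_{k-1,\ell}+\beta X_{k,\ell-1}+\gamma X_{k-1,\ell-1}+\varepsilon_{k,\ell}\quad (k,\ell\ge 1),\qquad X_{k,0}=X_{0,\ell}=0\quad (k,\ell\ge 0).$$ For $n\in\mathbb N=\{1,2,\dots\}$ and real $s,t\ge 0$ put $$Y^{(n)}_{1,0}(s,t):=X_{[ns]+1,[nt]},\qquad Y^{(n)}_{0,1}(s,t):=X_{[ns],[nt]+1},\qquad Y^{(n)}_{0,0}(s,t):=X_{[ns],[nt]},$$ where $[\cdot]$ denotes the integer part. Let $$\mathcal F_{++}:=\{(\alpha,\beta,\gamma)\in\mathbb R^3 : 0\le\alpha,\beta<1,\ |\gamma|<1,\ \alpha+\beta+\gamma=1\}.$$ If $(\alpha,\beta,\gamma)\in\mathcal F_{++}$, then there exists a constant $K_{\alpha,\beta}>0$,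 depending only on $\alpha$ and $\beta$, such that $$\Big|\mathrm{Cov}\big(Y^{(n)}_{i,j}(s_1,t_1),Y^{(n)}_{0,0}(s_2,t_2)\big)-\mathrm{Cov}\big(Y^{(n)}_{0,0}(s_1,t_1),Y^{(n)}_{0,0}(s_2,t_2)\big)\Big|\le K_{\alpha,\beta}$$ for all $n\in\mathbb N$, all real $s_1,t_1,s_2,t_2>0$ and all $(i,j)\in\{(0,1),(1,0)\}$. -/

import Mathlib

open MeasureTheory ProbabilityTheory

namespace SpatialAR

/-- The parameter set `F₊₊`. -/
def FPlusPlus : Set (ℝ × ℝ × ℝ) :=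
  {p | 0 ≤ p.1 ∧ p.1 < 1 ∧ 0 ≤ p.2.1 ∧ p.2.1 < 1 ∧ |p.2.2| < 1 ∧ p.1 + p.2.1 + p.2.2 = 1}

/-- The innovations `ε k ℓ` with `k, ℓ ≥ 1` are independent random variables with mean zero and
variance one. The values of `ε` at other indices are irrelevant. -/
structure IsInnovation {Ω : Type*} [MeasurableSpace Ω] (P : Measure Ω)
    (ε : ℕ → ℕ → Ω → ℝ) : Prop where
  measurable : ∀ k ℓ, 1 ≤ k → 1 ≤ ℓ → Measurable (ε k ℓ)
  indep : iIndepFun (fun p : {p : ℕ × ℕ // 1 ≤ p.1 ∧ 1 ≤ p.2} => ε p.1.1 p.1.2) P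
  memLp_two : ∀ k ℓ, 1 ≤ k → 1 ≤ ℓ → MemLp (ε k ℓ) 2 P
  mean_zero : ∀ k ℓ, 1 ≤ k → 1 ≤ ℓ → P[ε k ℓ] = 0
  variance_one : ∀ k ℓ, 1 ≤ k → 1 ≤ ℓ → Var[ε k ℓ; P] = 1

/-- The spatial autoregressive process: `X k ℓ = α X (k-1) ℓ + β X k (ℓ-1) + γ X (k-1) (ℓ-1) + ε k ℓ`
for `k, ℓ ≥ 1`, with `X k 0 = X 0 ℓ = 0`. -/
def X {Ω : Type*} (α β γ : ℝ) (ε : ℕ → ℕ → Ω → ℝ) : ℕ → ℕ → Ω → ℝ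
  | 0, _ => fun _ => 0
  | _ + 1, 0 => fun _ => 0
  | k + 1, ℓ + 1 => fun ω =>
      α * X α β γ ε k (ℓ + 1) ω + β * X α β γ ε (k + 1) ℓ ω + γ * X α β γ ε k ℓ ω
        + ε (k + 1) (ℓ + 1) ω
  termination_by k ℓ => k + ℓ

/-- The piecewise constant random field `Y i j (s, t) = X ([ns] + i) ([nt] + j)`, for `s, t ≥ 0`. -/
noncomputable def Y {Ω : Type*} (α β γ : ℝ) (ε : ℕ → ℕ → Ω → ℝ) (n i j : ℕ) (s t : ℝ) : Ω → ℝ :=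
  X α β γ ε (⌊(n : ℝ) * s⌋₊ + i) (⌊(n : ℝ) * t⌋₊ + j)

end SpatialAR

/-! Fix `(a, b)` and let c(k, ℓ) be the covariance of X(k, ℓ) with X(a, b). It solves the
autoregression with zero boundary values and a source, the Green function reflected at `(a, b)`.
Since γ = 1 - α - β, the increments p = c(k+1, ℓ) - c(k, ℓ) and q = c(k, ℓ) - c(k, ℓ+1) satisfy a
first-order system with nonnegative coefficients; without source it preserves |p| ≤ (1-α)C, |q| ≤
(1-β)C (`abs_increment_le_of_homogeneous`). The source is absorbed by an explicit particular
solution built from the Green function and its row sums, bounded by `green_add_greenSum_le_one`.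
Subtracting it bounds the increments on the rectangle below `(a, b)`; beyond it the system is
homogeneous and the bound propagates (`abs_increment_le`). -/

namespace SpatialAR

/-- The Green function of the autoregression: the coefficient of `x ^ m * y ^ n` in the power series
`1 / (1 - α x - β y - γ x y)`. -/
def green (α β γ : ℝ) : ℕ → ℕ → ℝ
  | 0, 0 => 1
  | 0, n + 1 => β * green α β γ 0 n
  | m + 1, 0 => α * green α β γ m 0
  | m + 1, n + 1 =>
      α * green α β γ m (n + 1) + β * green α β γ (m + 1) n + γ * green α β γ m n
  termination_by m n => m + n

/-- The row sums `∑ w < n, green m w`. -/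
def greenSum (α β γ : ℝ) (m n : ℕ) : ℝ :=
  ∑ w ∈ Finset.range n, green α β γ m w

/-! ### Positivity and row-sum bounds for the Green function. -/

section Green

variable {α β : ℝ}

/-- Positivity is not termwise, as γ may be negative. The second claim closes the induction: G(m+1,
n+1) - βG(m+1, n) = α(G(m, n+1) - βG(m, n)) + (γ + αβ)G(m, n). -/
lemma green_nonneg_and_mul_le_succ {γ : ℝ} (hα : 0 ≤ α) (hβ : 0 ≤ β) (hδ : 0 ≤ γ + α * β) (m : ℕ) :
    (∀ n, 0 ≤ green α β γ m n) ∧ ∀ n, β * green α β γ m n ≤ green α β γ m (n + 1) := by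
  induction m with
  | zero =>
    refine ⟨fun n => ?_, fun n => by rw [green]⟩
    induction n with
    | zero => rw [green]; exact zero_le_one
    | succ n ih => rw [green]; exact mul_nonneg hβ ih
  | succ m ih =>
    have key : ∀ n, β * green α β γ (m + 1) n ≤ green α β γ (m + 1) (n + 1) := by
      intro n
      rw [green.eq_4]
      have h₁ := mul_nonneg hα (sub_nonneg.2 (ih.2 n))
      have h₂ := mul_nonneg hδ (ih.1 n)
      linarith
    refine ⟨fun n => ?_, key⟩
    induction n with
    | zero => rw [green]; exact mul_nonneg hα (ih.1 0)
    | succ n ihn => exact (mul_nonneg hβ ihn).trans (key n)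

lemma green_nonneg (hα : 0 ≤ α) (hα' : α < 1) (hβ : 0 ≤ β) (hβ' : β < 1) (m n : ℕ) :
    0 ≤ green α β (1 - α - β) m n := by
  refine (green_nonneg_and_mul_le_succ hα hβ ?_ m).1 n
  -- Here γ + αβ = (1-α)(1-β).
  have := mul_pos (sub_pos.2 hα') (sub_pos.2 hβ')
  linarith

lemma greenSum_succ (γ : ℝ) (m n : ℕ) :
    greenSum α β γ m (n + 1) = greenSum α β γ m n + green α β γ m n :=
  Finset.sum_range_succ _ _

lemma greenSum_nonneg (hα : 0 ≤ α) (hα' : α < 1) (hβ : 0 ≤ β) (hβ' : β < 1) (m n : ℕ) :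
    0 ≤ greenSum α β (1 - α - β) m n :=
  Finset.sum_nonneg fun _ _ => green_nonneg hα hα' hβ hβ' _ _

/-- Conservation law for the Green function. -/
lemma green_add_greenSum_succ (m n : ℕ) :
    green α β (1 - α - β) (m + 1) n + (1 - β) * greenSum α β (1 - α - β) (m + 1) n =
      α * green α β (1 - α - β) m n + (1 - β) * greenSum α β (1 - α - β) m n := by
  induction n with
  | zero => simp [greenSum, green]
  | succ n ih =>
    rw [greenSum_succ, greenSum_succ, green.eq_4]
    linear_combination ih

/-- Equality holds in row 0, and by the conservation law passing from row m to m+1 loses (1-α)G(m,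
n) ≥ 0. -/
lemma green_add_greenSum_le_one (hα : 0 ≤ α) (hα' : α < 1) (hβ : 0 ≤ β) (hβ' : β < 1) (m n : ℕ) :
    green α β (1 - α - β) m n + (1 - β) * greenSum α β (1 - α - β) m n ≤ 1 := by
  induction m with
  | zero =>
    apply le_of_eq
    induction n with
    | zero => simp [greenSum, green]
    | succ n ih =>
      rw [greenSum_succ, green.eq_2]
      linear_combination ih
  | succ m ih =>
    rw [green_add_greenSum_succ]
    have := mul_nonneg (sub_nonneg.2 hα'.le) (green_nonneg hα hα' hβ hβ' m n)
    linarith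

end Green

/-! ### Bounds for the increment system. -/

section Increments

variable {α β : ℝ}

/-- Maximum principle for the increments of a solution of the homogeneous recursion on a
rectangle. -/
lemma abs_increment_le_of_homogeneous (hα : 0 ≤ α) (hα' : α < 1) (hβ : 0 ≤ β) (hβ' : β < 1)
    {C : ℝ} {p q : ℕ → ℕ → ℝ} {M N : ℕ}
    (hp : ∀ i < M, ∀ j < N, p i (j + 1) = β * p i j + (1 - α) * q i j)
    (hq : ∀ i < M, ∀ j < N, q (i + 1) j = α * q i j + (1 - β) * p i j)
    (hp0 : ∀ i < M, |p i 0| ≤ (1 - α) * C) (hq0 : ∀ j < N, |q 0 j| ≤ (1 - β) * C) :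
    (∀ i < M, ∀ j ≤ N, |p i j| ≤ (1 - α) * C) ∧ ∀ i ≤ M, ∀ j < N, |q i j| ≤ (1 - β) * C := by
  have comb : ∀ {r s x y : ℝ} (A B : ℝ), 0 ≤ r → 0 ≤ s → |x| ≤ A → |y| ≤ B →
      |r * x + s * y| ≤ r * A + s * B := by
    intro r s x y A B hr hs hx hy
    refine (abs_add_le _ _).trans ?_
    rw [abs_mul, abs_mul, abs_of_nonneg hr, abs_of_nonneg hs]
    gcongr
  have row : ∀ i < M, (∀ j < N, |q i j| ≤ (1 - β) * C) → ∀ j ≤ N, |p i j| ≤ (1 - α) * C := by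
    intro i hi hqi j
    induction j with
    | zero => exact fun _ => hp0 i hi
    | succ j ih =>
      intro hj
      rw [hp i hi j hj]
      -- The weights match: β(1-α) + (1-α)(1-β) = 1-α.
      refine (comb _ _ hβ (sub_nonneg.2 hα'.le) (ih (by omega)) (hqi j hj)).trans_eq ?_
      ring
  have col : ∀ i ≤ M, ∀ j < N, |q i j| ≤ (1 - β) * C := by
    intro i
    induction i with
    | zero => exact fun _ => hq0
    | succ i ih =>
      intro hi j hj
      have hqi := ih (by omega)
      rw [hq i hi j hj]
      refine (comb _ _ hα (sub_nonneg.2 hβ'.le) (hqi j hj) (row i hi hqi j hj.le)).trans_eq ?_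
      ring
  exact ⟨fun i hi => row i hi (col i hi.le), col⟩

/-- The increments of a solution of the recursion with zero boundary values and the reflected Green
function as its source are bounded uniformly in the corner `(a, b)` of the source. -/
lemma abs_increment_le (hα : 0 ≤ α) (hα' : α < 1) (hβ : 0 ≤ β) (hβ' : β < 1) (hαβ : 0 < α + β)
    {p q s : ℕ → ℕ → ℝ} {a b : ℕ}
    (hp : ∀ i j, p i (j + 1) = β * p i j + (1 - α) * q i j + s i j)
    (hq : ∀ i j, q (i + 1) j = α * q i j + (1 - β) * p i j - s i j)
    (hp0 : ∀ i, p i 0 = 0) (hq0 : ∀ j, q 0 j = 0)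
    (hs : ∀ i j m n, i + 1 + m = a → j + 1 + n = b → s i j = green α β (1 - α - β) m n)
    (hs0 : ∀ i j, (a ≤ i ∨ b ≤ j) → s i j = 0) (i j : ℕ) :
    |p i j| ≤ (1 - α) * (2 / ((1 - α) * (1 - β) * (α + β))) ∧
      |q i j| ≤ (1 - β) * (2 / ((1 - α) * (1 - β) * (α + β))) := by
  have hα1 : 0 < 1 - α := sub_pos.2 hα'
  have hβ1 : 0 < 1 - β := sub_pos.2 hβ'
  -- Normalised so that the residual (1-α)(1-β)(α+β)D·G in `hP` and `hQ` is exactly the source G.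
  set D : ℝ := 1 / ((1 - α) * (1 - β) * (α + β)) with hD
  have hDpos : 0 < D := by positivity
  have h2D : 2 / ((1 - α) * (1 - β) * (α + β)) = D + D := by rw [hD]; ring
  have hD1 : D * ((1 - α) * (1 - β) * (α + β)) = 1 := by
    rw [hD]; exact one_div_mul_cancel (by positivity)
  rw [h2D]
  -- A bounded solution of the equations for the increments in the rectangle of the source.
  let P : ℕ → ℕ → ℝ := fun m n => -((1 - α) * (1 - β) * D * greenSum α β (1 - α - β) m n)
  let Q : ℕ → ℕ → ℝ := fun m n => -((1 - β) * D *
    (green α β (1 - α - β) m n + (1 - β) * greenSum α β (1 - α - β) m n))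
  have hP : ∀ m n, P m n = β * P m (n + 1) + (1 - α) * Q (m + 1) n + green α β (1 - α - β) m n := by
    intro m n
    simp only [P, Q, greenSum_succ, green_add_greenSum_succ]
    linear_combination (green α β (1 - α - β) m n) * hD1
  have hQ : ∀ m n, Q m n = α * Q (m + 1) n + (1 - β) * P m (n + 1) - green α β (1 - α - β) m n := by
    intro m n
    simp only [P, Q, greenSum_succ, green_add_greenSum_succ]
    linear_combination (-green α β (1 - α - β) m n) * hD1
  have hPb : ∀ m n, |P m n| ≤ (1 - α) * D := by
    intro m n
    have h₀ := green_nonneg hα hα' hβ hβ' m n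
    have h₁ := greenSum_nonneg hα hα' hβ hβ' m n
    have h₂ := green_add_greenSum_le_one hα hα' hβ hβ' m n
    rw [abs_neg, abs_of_nonneg (by positivity)]
    calc _ = (1 - α) * D * ((1 - β) * greenSum α β (1 - α - β) m n) := by ring
      _ ≤ (1 - α) * D * 1 := by gcongr; linarith
      _ = _ := mul_one _
  have hQb : ∀ m n, |Q m n| ≤ (1 - β) * D := by
    intro m n
    have h₀ := green_nonneg hα hα' hβ hβ' m n
    have h₁ := greenSum_nonneg hα hα' hβ hβ' m n
    have h₂ := green_add_greenSum_le_one hα hα' hβ hβ' m n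
    rw [abs_neg, abs_of_nonneg (by positivity)]
    calc _ ≤ (1 - β) * D * 1 := by gcongr
      _ = _ := mul_one _
  -- The difference from the reflected particular solution is homogeneous; as p and q vanish on the
  -- axes, its boundary data are those of -P and -Q.
  have inner := abs_increment_le_of_homogeneous hα hα' hβ hβ' (C := D) (M := a) (N := b)
    (p := fun i j => p i j - P (a - (i + 1)) (b - j))
    (q := fun i j => q i j - Q (a - i) (b - (j + 1)))
    (by
      intro i hi j hj
      obtain ⟨m, rfl⟩ := Nat.exists_eq_add_of_le hi
      obtain ⟨n, rfl⟩ := Nat.exists_eq_add_of_le hj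
      have e₁ : i.succ + m - (i + 1) = m := by omega
      have e₂ : j.succ + n - (j + 1) = n := by omega
      have e₃ : i.succ + m - i = m + 1 := by omega
      have e₄ : j.succ + n - j = n + 1 := by omega
      simp only [e₁, e₂, e₃, e₄]
      linear_combination hp i j - hP m n + hs i j m n rfl rfl)
    (by
      intro i hi j hj
      obtain ⟨m, rfl⟩ := Nat.exists_eq_add_of_le hi
      obtain ⟨n, rfl⟩ := Nat.exists_eq_add_of_le hj
      have e₁ : i.succ + m - (i + 1) = m := by omega
      have e₂ : j.succ + n - (j + 1) = n := by omega
      have e₃ : i.succ + m - i = m + 1 := by omega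
      have e₄ : j.succ + n - j = n + 1 := by omega
      simp only [e₁, e₂, e₃, e₄]
      linear_combination hq i j - hQ m n - hs i j m n rfl rfl)
    (fun i _ => by simpa [hp0] using hPb _ _)
    (fun j _ => by simpa [hq0] using hQb _ _)
  have transfer : ∀ {c x y : ℝ}, |x - y| ≤ c * D → |y| ≤ c * D → |x| ≤ c * (D + D) := by
    intro c x y h₁ h₂
    have := abs_add_le (x - y) y
    rw [sub_add_cancel] at this
    linarith
  have hpin : ∀ i < a, ∀ j ≤ b, |p i j| ≤ (1 - α) * (D + D) :=
    fun i hi j hj => transfer (inner.1 i hi j hj) (hPb _ _)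
  have hqin : ∀ i ≤ a, ∀ j < b, |q i j| ≤ (1 - β) * (D + D) :=
    fun i hi j hj => transfer (inner.2 i hi j hj) (hQb _ _)
  -- Above the source rectangle, the row j = b supplies the data for p, and q vanishes at i = 0.
  have top := fun N => abs_increment_le_of_homogeneous hα hα' hβ hβ' (C := D + D) (M := a) (N := N)
    (p := fun i j => p i (b + j)) (q := fun i j => q i (b + j))
    (by
      intro i _ j _
      have := hp i (b + j)
      rwa [hs0 i (b + j) (Or.inr (Nat.le_add_right _ _)), add_zero] at this)
    (by
      intro i _ j _
      have := hq i (b + j)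
      rwa [hs0 i (b + j) (Or.inr (Nat.le_add_right _ _)), sub_zero] at this)
    (fun i hi => hpin i hi b le_rfl)
    (fun j _ => by simp only [hq0, abs_zero]; positivity)
  have hpl : ∀ i < a, ∀ j, |p i j| ≤ (1 - α) * (D + D) := by
    intro i hi j
    rcases le_total j b with hj | hj
    · exact hpin i hi j hj
    · obtain ⟨n, rfl⟩ := Nat.exists_eq_add_of_le hj
      exact (top n).1 i hi n le_rfl
  have hql : ∀ i ≤ a, ∀ j, |q i j| ≤ (1 - β) * (D + D) := by
    intro i hi j
    rcases lt_or_ge j b with hj | hj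
    · exact hqin i hi j hj
    · obtain ⟨n, rfl⟩ := Nat.exists_eq_add_of_le hj
      exact (top (n + 1)).2 i hi n (Nat.lt_succ_self n)
  -- To the right, the column i = a supplies the data for q, and p vanishes at j = 0.
  have right := fun M N => abs_increment_le_of_homogeneous hα hα' hβ hβ' (C := D + D) (M := M)
    (N := N) (p := fun i j => p (a + i) j) (q := fun i j => q (a + i) j)
    (by
      intro i _ j _
      have := hp (a + i) j
      rwa [hs0 (a + i) j (Or.inl (Nat.le_add_right _ _)), add_zero] at this)
    (by
      intro i _ j _
      have := hq (a + i) j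
      rwa [hs0 (a + i) j (Or.inl (Nat.le_add_right _ _)), sub_zero] at this)
    (fun i _ => by simp only [hp0, abs_zero]; positivity)
    (fun j _ => hql a le_rfl j)
  constructor
  · rcases lt_or_ge i a with hi | hi
    · exact hpl i hi j
    · obtain ⟨m, rfl⟩ := Nat.exists_eq_add_of_le hi
      exact (right (m + 1) j).1 m (Nat.lt_succ_self m) j le_rfl
  · rcases le_total i a with hi | hi
    · exact hql i hi j
    · obtain ⟨m, rfl⟩ := Nat.exists_eq_add_of_le hi
      exact (right m (j + 1)).2 m le_rfl j (Nat.lt_succ_self j)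

end Increments

/-! ### Covariances of the process as a solution of the recursion. -/

section Covariance

variable {Ω : Type*} {α β γ : ℝ} {ε : ℕ → ℕ → Ω → ℝ}

lemma X_zero_left (ℓ : ℕ) : X α β γ ε 0 ℓ = fun _ => 0 := by
  rw [X]

lemma X_zero_right (k : ℕ) : X α β γ ε k 0 = fun _ => 0 := by
  cases k <;> rw [X]

lemma X_succ_succ (k ℓ : ℕ) :
    X α β γ ε (k + 1) (ℓ + 1) =
      α • X α β γ ε k (ℓ + 1) + β • X α β γ ε (k + 1) ℓ + γ • X α β γ ε k ℓ
        + ε (k + 1) (ℓ + 1) := by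
  rw [X]
  rfl

variable [MeasurableSpace Ω] {P : Measure Ω}

lemma IsInnovation.covariance_eq_zero (hε : IsInnovation P ε) {k ℓ k' ℓ' : ℕ}
    (hk : 1 ≤ k) (hℓ : 1 ≤ ℓ) (hk' : 1 ≤ k') (hℓ' : 1 ≤ ℓ') (h : (k, ℓ) ≠ (k', ℓ')) :
    cov[ε k ℓ, ε k' ℓ'; P] = 0 := by
  have := hε.indep.indepFun (i := ⟨(k, ℓ), hk, hℓ⟩) (j := ⟨(k', ℓ'), hk', hℓ'⟩)
    (fun e => h (Subtype.ext_iff.1 e))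
  exact this.covariance_eq_zero (hε.memLp_two _ _ hk hℓ) (hε.memLp_two _ _ hk' hℓ')

lemma IsInnovation.covariance_self (hε : IsInnovation P ε) {k ℓ : ℕ} (hk : 1 ≤ k) (hℓ : 1 ≤ ℓ) :
    cov[ε k ℓ, ε k ℓ; P] = 1 := by
  rw [ProbabilityTheory.covariance_self (hε.measurable _ _ hk hℓ).aemeasurable,
    hε.variance_one _ _ hk hℓ]

variable [IsProbabilityMeasure P]

lemma memLp_X (hε : IsInnovation P ε) (k ℓ : ℕ) : MemLp (X α β γ ε k ℓ) 2 P := by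
  induction k generalizing ℓ with
  | zero => rw [X_zero_left]; exact memLp_const 0
  | succ k ihk =>
    induction ℓ with
    | zero => rw [X_zero_right]; exact memLp_const 0
    | succ ℓ ih =>
      rw [X_succ_succ]
      exact ((((ihk _).const_smul α).add (ih.const_smul β)).add ((ihk _).const_smul γ)).add
        (hε.memLp_two _ _ (by omega) (by omega))

lemma covariance_X_succ_succ (hε : IsInnovation P ε) {Z : Ω → ℝ} (hZ : MemLp Z 2 P) (k ℓ : ℕ) :
    cov[X α β γ ε (k + 1) (ℓ + 1), Z; P] =
      α * cov[X α β γ ε k (ℓ + 1), Z; P] + β * cov[X α β γ ε (k + 1) ℓ, Z; P]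
        + γ * cov[X α β γ ε k ℓ, Z; P] + cov[ε (k + 1) (ℓ + 1), Z; P] := by
  have h₁ := (memLp_X (α := α) (β := β) (γ := γ) hε k (ℓ + 1)).const_smul α
  have h₂ := (memLp_X (α := α) (β := β) (γ := γ) hε (k + 1) ℓ).const_smul β
  have h₃ := (memLp_X (α := α) (β := β) (γ := γ) hε k ℓ).const_smul γ
  rw [X_succ_succ, covariance_add_left ((h₁.add h₂).add h₃)
    (hε.memLp_two _ _ (by omega) (by omega)) hZ, covariance_add_left (h₁.add h₂) h₃ hZ,
    covariance_add_left h₁ h₂ hZ, covariance_smul_left, covariance_smul_left, covariance_smul_left]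

/-- The process does not depend on innovations outside the rectangle below it. -/
lemma covariance_X_innovation_eq_zero (hε : IsInnovation P ε) {k ℓ : ℕ} (hk : 1 ≤ k) (hℓ : 1 ≤ ℓ)
    (a b : ℕ) (h : a < k ∨ b < ℓ) : cov[X α β γ ε a b, ε k ℓ; P] = 0 := by
  induction a generalizing b with
  | zero => rw [X_zero_left, covariance_const_left]
  | succ a iha =>
    induction b with
    | zero => rw [X_zero_right, covariance_const_left]
    | succ b ihb =>
      rw [covariance_X_succ_succ hε (hε.memLp_two _ _ hk hℓ), iha (b + 1) (by omega),
        ihb (by omega), iha b (by omega), hε.covariance_eq_zero (by omega) (by omega) hk hℓ]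
      · simp
      · rw [Ne, Prod.mk.injEq]
        omega

/-- Both sides obey the same recursion in (m, n), with unit source at the origin and zero values
outside the quadrant. -/
lemma covariance_X_innovation (hε : IsInnovation P ε) (k ℓ m n : ℕ) :
    cov[X α β γ ε (k + m + 1) (ℓ + n + 1), ε (k + 1) (ℓ + 1); P] = green α β γ m n := by
  have hk : 1 ≤ k + 1 := by omega
  have hℓ : 1 ≤ ℓ + 1 := by omega
  have hL := hε.memLp_two _ _ hk hℓ
  have hz := covariance_X_innovation_eq_zero (α := α) (β := β) (γ := γ) hε hk hℓ
  have hne : ∀ i j, (i, j) ≠ (0, 0) →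
      cov[ε (k + i + 1) (ℓ + j + 1), ε (k + 1) (ℓ + 1); P] = 0 := by
    intro i j hij
    refine hε.covariance_eq_zero (by omega) (by omega) hk hℓ ?_
    rw [Ne, Prod.mk.injEq] at hij ⊢
    omega
  induction m generalizing n with
  | zero =>
    induction n with
    | zero =>
      rw [covariance_X_succ_succ hε hL, hz _ _ (by omega), hz _ _ (by omega), hz _ _ (by omega),
        green]
      simp [hε.covariance_self hk hℓ]
    | succ n ihn =>
      rw [covariance_X_succ_succ hε hL, hz _ _ (by omega), hz k _ (by omega),
        hne 0 (n + 1) (by simp), green]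
      have en : ℓ + (n + 1) = ℓ + n + 1 := by omega
      rw [en, ihn]
      ring
  | succ m ihm =>
    have em : k + (m + 1) = k + m + 1 := by omega
    induction n with
    | zero =>
      have h₀ := ihm 0
      rw [add_zero] at h₀
      rw [covariance_X_succ_succ hε hL, hz (k + (m + 1) + 1) _ (by omega),
        hz (k + (m + 1)) ℓ (by omega), hne (m + 1) 0 (by simp), em, h₀, green]
      ring
    | succ n ihn =>
      have en : ℓ + (n + 1) = ℓ + n + 1 := by omega
      rw [covariance_X_succ_succ hε hL, hne (m + 1) (n + 1) (by simp), en, ihn, em, ← en, ihm, en,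
        ihm, green]
      ring

lemma abs_covariance_increment_le (hε : IsInnovation P ε) (hα : 0 ≤ α) (hα' : α < 1) (hβ : 0 ≤ β)
    (hβ' : β < 1) (hαβ : 0 < α + β) (hγ : γ = 1 - α - β) (a b k ℓ : ℕ) :
    |cov[X α β γ ε (k + 1) ℓ, X α β γ ε a b; P] - cov[X α β γ ε k ℓ, X α β γ ε a b; P]| ≤
        (1 - α) * (2 / ((1 - α) * (1 - β) * (α + β))) ∧
      |cov[X α β γ ε k ℓ, X α β γ ε a b; P] - cov[X α β γ ε k (ℓ + 1), X α β γ ε a b; P]| ≤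
        (1 - β) * (2 / ((1 - α) * (1 - β) * (α + β))) := by
  subst hγ
  refine abs_increment_le hα hα' hβ hβ' hαβ (a := a) (b := b)
    (p := fun k ℓ => cov[X α β (1 - α - β) ε (k + 1) ℓ, X α β (1 - α - β) ε a b; P] -
      cov[X α β (1 - α - β) ε k ℓ, X α β (1 - α - β) ε a b; P])
    (q := fun k ℓ => cov[X α β (1 - α - β) ε k ℓ, X α β (1 - α - β) ε a b; P] -
      cov[X α β (1 - α - β) ε k (ℓ + 1), X α β (1 - α - β) ε a b; P])
    (s := fun k ℓ => cov[ε (k + 1) (ℓ + 1), X α β (1 - α - β) ε a b; P])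
    (fun k ℓ => ?_) (fun k ℓ => ?_) (fun k => ?_) (fun ℓ => ?_) (fun i j m n hm hn => ?_)
    (fun i j hij => ?_) k ℓ
  · linear_combination covariance_X_succ_succ (α := α) (β := β) (γ := 1 - α - β) hε
      (memLp_X hε a b) k ℓ
  · linear_combination -covariance_X_succ_succ (α := α) (β := β) (γ := 1 - α - β) hε
      (memLp_X hε a b) k ℓ
  · simp only [X_zero_right, covariance_const_left, sub_zero]
  · simp only [X_zero_left, covariance_const_left, sub_zero]
  · rw [covariance_comm, ← covariance_X_innovation hε i j m n]
    congr 2 <;> omega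
  · rw [covariance_comm, covariance_X_innovation_eq_zero hε (by omega) (by omega)]
    omega

end Covariance

end SpatialAR

/-- The constant `K α β` depends on `α` and `β` only; it is the same for all probability spaces,
innovations, `n`, and `s₁, t₁, s₂, t₂ > 0`. -/
theorem proposition2p3 :
    ∃ K : ℝ → ℝ → ℝ, ∀ α β γ : ℝ, (α, β, γ) ∈ SpatialAR.FPlusPlus →
      0 < K α β ∧
      ∀ (Ω : Type*) [MeasurableSpace Ω] (P : Measure Ω) [IsProbabilityMeasure P]
        (ε : ℕ → ℕ → Ω → ℝ), SpatialAR.IsInnovation P ε →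
      ∀ (n : ℕ), 1 ≤ n → ∀ s₁ t₁ s₂ t₂ : ℝ, 0 < s₁ → 0 < t₁ → 0 < s₂ → 0 < t₂ →
      ∀ i j : ℕ, ((i, j) = (0, 1) ∨ (i, j) = (1, 0)) →
        |cov[SpatialAR.Y α β γ ε n i j s₁ t₁, SpatialAR.Y α β γ ε n 0 0 s₂ t₂; P]
          - cov[SpatialAR.Y α β γ ε n 0 0 s₁ t₁, SpatialAR.Y α β γ ε n 0 0 s₂ t₂; P]| ≤ K α β := by
  refine ⟨fun α β => 2 / ((1 - α) * (1 - β) * (α + β)), ?_⟩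
  rintro α β γ ⟨hα, hα', hβ, hβ', hγ, hsum⟩
  dsimp only at hα hα' hβ hβ' hγ hsum
  -- The bound γ < 1 excludes α = β = 0, where the constant would degenerate.
  have hαβ : 0 < α + β := by linarith [(abs_lt.1 hγ).2]
  have hα1 : 0 < 1 - α := sub_pos.2 hα'
  have hβ1 : 0 < 1 - β := sub_pos.2 hβ'
  have hK : 0 < 2 / ((1 - α) * (1 - β) * (α + β)) := by positivity
  refine ⟨hK, ?_⟩
  intro Ω _ P _ ε hε n _ s₁ t₁ s₂ t₂ _ _ _ _ i j hij
  have key := SpatialAR.abs_covariance_increment_le (γ := γ) hε hα hα' hβ hβ' hαβ (by linarith)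
    ⌊(n : ℝ) * s₂⌋₊ ⌊(n : ℝ) * t₂⌋₊ ⌊(n : ℝ) * s₁⌋₊ ⌊(n : ℝ) * t₁⌋₊
  rcases hij with h | h <;> obtain ⟨rfl, rfl⟩ := Prod.mk.inj h
  · simp only [SpatialAR.Y, add_zero]
    -- The increment q is taken with decreasing second index, hence the swap.
    rw [abs_sub_comm]
    exact key.2.trans (mul_le_of_le_one_left hK.le (by linarith))
  · simp only [SpatialAR.Y, add_zero]
    exact key.1.trans (mul_le_of_le_one_left hK.le (by linarith))
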